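/- Let $X$ be a weakly systolic complex that is uniformly locally finite, meaning that there is $N$ such that every vertex is contained in at most $N$ simplices. Let $h$ be a hyperbolic simplicial isometry of $X$ and let $n\ge 1$. If there is an $h^n$-invariant geodesic in $X$, then for every vertex $x$ of $\mathrm{Min}_X(h^n)$ there is an $h^n$-invariant geodesic in $X$ passing through $x$. Here the following conventions are used. $X^{(1)}$ is the $1$-skeleton of $X$, and $d$ is the combinatorial metric on the vertex set $X^{(0)}$: $d(u,v)$ is the number of edges of a shortest path in $X^{(1)}$ from $u$ to $v$. For a simplex $\sigma$, the link $X_\sigma$ consists of the simplices of $X$ that are disjoint from $\sigma$ and together with $\sigma$ span a simplex of $X$. The complex $X$ is *weakly systolic* if it is connected, it is flag (every nonempty finite set of vertices that are pairwise joined by edges spans a simplex), and for every vertex $v$, every $i\ge 0$ and every simplex $\sigma$ all of whose vertices are at distance $i+1$ from $v$, the set of vertices $w$ of $X_\sigma$ with $d(v,w)\le i$ is the vertex set of a nonempty simplex of $X$. A *simplicial isometry* of $X$ is a simplicial automorphism of $X$ (it automatically preserves $d$). It is *hyperbolic* if it maps no simplex of $X$ onto itself. For a simplicial isometry $g$, $\mathrm{Min}_X(g)$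 is the full subcomplex of $X$ spanned by the vertices at which $x\mapsto d(g(x),x)$ attains its minimum over $X^{(0)}$. A *geodesic* is a map $\gamma:\mathbb Z\to X^{(0)}$ with $d(\gamma(a),\gamma(b))=|a-b|$ for all $a,b\in\mathbb Z$. It is *$g$-invariant* if $g(\gamma(\mathbb Z))=\gamma(\mathbb Z)$, and it *passes through* $x$ if $x\in\gamma(\mathbb Z)$. -/

import Mathlib

namespace AbstractSimplicialComplex

variable {V : Type*}

/-- The `1`-skeleton of a simplicial complex, as a simple graph on its vertex set. -/
def oneSkeleton (X : AbstractSimplicialComplex V) : SimpleGraph V where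
  Adj u v := u ≠ v ∧ ∃ s ∈ X, (s : Set V) = {u, v}
  symm := ⟨fun _ _ h => ⟨h.1.symm, by
    obtain ⟨s, hs, hsv⟩ := h.2
    exact ⟨s, hs, by rw [hsv, Set.pair_comm]⟩⟩⟩
  loopless := ⟨fun _ h => h.1 rfl⟩

/-- The combinatorial metric: the number of edges in a shortest path of the `1`-skeleton
(meaningful for vertices in the same connected component). -/
noncomputable def vdist (X : AbstractSimplicialComplex V) (u v : V) : ℕ :=
  X.oneSkeleton.dist u v

/-- Every nonempty finite set of vertices which are pairwise connected by edges spans a simplex. -/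
def IsFlag (X : AbstractSimplicialComplex V) : Prop :=
  ∀ s : Finset V, s.Nonempty →
    (∀ u ∈ s, ∀ v ∈ s, u ≠ v → X.oneSkeleton.Adj u v) → s ∈ X

open Classical in
/-- The link of `X` at `σ`: the simplices of `X` that are disjoint from `σ` and
together with `σ` span a simplex of `X`. -/
def link (X : AbstractSimplicialComplex V) (σ : Finset V) : PreAbstractSimplicialComplex V where
  faces := {τ | τ ∈ X ∧ Disjoint τ σ ∧ τ ∪ σ ∈ X}
  isRelLowerSet_faces := by
    rintro τ ⟨h1, h2, h3⟩
    have h4 := (X.isRelLowerSet_faces h1).1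
    refine ⟨h4, fun ρ hρ hne => ⟨(X.isRelLowerSet_faces h1).2 hρ hne, ?_, ?_⟩⟩
    · exact Finset.disjoint_of_subset_left hρ h2
    · exact (X.isRelLowerSet_faces h3).2 (Finset.union_subset_union_left hρ)
        (hne.mono Finset.subset_union_left)

/-- The property `SD_n(v)`: for each `i ≤ n` and each simplex `σ` with all vertices in the sphere of
radius `i + 1` around `v`, the set of vertices of the link of `σ` lying in the ball of
radius `i` around `v` is the vertex set of a (nonempty) simplex of `X`. -/
def SD (X : AbstractSimplicialComplex V) (n : ℕ) (v : V) : Prop :=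
  ∀ i ≤ n, ∀ σ ∈ X, (∀ u ∈ σ, X.vdist v u = i + 1) →
    ∃ ρ ∈ X, (ρ : Set V) = {w | {w} ∈ X.link σ ∧ X.vdist v w ≤ i}

/-- Weakly systolic complexes: connected flag simplicial complexes with `SD_n(v)` for all `n`
and all vertices `v`. -/
structure IsWeaklySystolic (X : AbstractSimplicialComplex V) : Prop where
  connected : X.oneSkeleton.Connected
  flag : X.IsFlag
  sd : ∀ (v : V) (n : ℕ), X.SD n v

/-- There is a uniform bound on the number of simplices containing a given vertex. -/
def IsUniformlyLocallyFinite (X : AbstractSimplicialComplex V) : Prop :=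
  ∃ N : ℕ, ∀ v : V, {s : Finset V | s ∈ X ∧ v ∈ s}.encard ≤ N

/-- A simplicial isometry of `X` onto itself, given on vertices: a bijection of the vertex set
that is simplicial in both directions and preserves the combinatorial metric. -/
structure IsSimplicialIsometry (X : AbstractSimplicialComplex V) (h : Equiv.Perm V) : Prop where
  map_mem_iff : ∀ s : Finset V, s.map h.toEmbedding ∈ X ↔ s ∈ X
  vdist_map : ∀ u v : V, X.vdist (h u) (h v) = X.vdist u v

/-- No simplex of `X` is mapped by `h` onto itself. -/
def IsHyperbolic (X : AbstractSimplicialComplex V) (h : Equiv.Perm V) : Prop :=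
  ∀ s ∈ X, s.map h.toEmbedding ≠ s

/-- The displacement function `x ↦ d(h x, x)`. -/
noncomputable def displacement (X : AbstractSimplicialComplex V) (h : Equiv.Perm V) (x : V) : ℕ :=
  X.vdist (h x) x

/-- The translation length: the minimum of the displacement function. -/
noncomputable def translationLength (X : AbstractSimplicialComplex V) (h : Equiv.Perm V) : ℕ :=
  sInf (Set.range (X.displacement h))

/-- The full subcomplex of `X` spanned by a set of vertices. -/
def fullSubcomplex (X : AbstractSimplicialComplex V) (A : Set V) :
    PreAbstractSimplicialComplex V where
  faces := {s | s ∈ X ∧ (s : Set V) ⊆ A}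
  isRelLowerSet_faces := by
    rintro s ⟨h1, h2⟩
    refine ⟨(X.isRelLowerSet_faces h1).1, fun t ht hne => ⟨?_, ?_⟩⟩
    · exact (X.isRelLowerSet_faces h1).2 ht hne
    · exact (Finset.coe_subset.mpr ht).trans h2

/-- The minimal displacement set: the subcomplex spanned by the vertices at which the displacement
function attains its minimum. -/
noncomputable def minDisplacementSet (X : AbstractSimplicialComplex V) (h : Equiv.Perm V) :
    PreAbstractSimplicialComplex V :=
  X.fullSubcomplex {x | X.displacement h x = X.translationLength h}

/-- A (bi-infinite) geodesic in the `1`-skeleton, parametrized by `ℤ`. -/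
def IsGeodesicLine (X : AbstractSimplicialComplex V) (γ : ℤ → V) : Prop :=
  ∀ a b : ℤ, X.vdist (γ a) (γ b) = (a - b).natAbs

/-- A geodesic that is mapped by `g` onto itself, as a set. -/
def IsInvariantGeodesic (X : AbstractSimplicialComplex V) (g : Equiv.Perm V) (γ : ℤ → V) : Prop :=
  X.IsGeodesicLine γ ∧ g '' Set.range γ = Set.range γ

end AbstractSimplicialComplex

/-! ### Mod 2 chains of a finite complex and a Lefschetz argument. -/

section FixedFace

variable {V : Type*} [DecidableEq V] (K : Finset (Finset V))

/-! Write `g = h ^ n`. An isometry preserving a geodesic line acts on it as a translation or a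
reflection; unless the translation is nontrivial, `g ^ 2` fixes a vertex, so `h` has a periodic
vertex. Hyperbolicity excludes this (`exists_map_eq_of_periodic`). Hence `g` translates the given
line by some `t ≠ 0`, and its vertices are displaced by exactly `k * |t|` under `g ^ k`. A vertex
`x` of minimal displacement moves by at most `|t|`; since asymptotic displacement does not depend on
the vertex, `g ^ k` also moves `x` by exactly `k * |t|` (`vdist_pow_eq_mul`). The translates of a
shortest path from `x` to `g x` then concatenate to an invariant geodesic.

The main work is the fixed simplex. Around a periodic orbit, the intersection of balls of a common
large radius is finite and `h`-invariant, and it is geodesically convex because balls are. Its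
cliques collapse towards an orbit point `v` by projecting the vertices farthest from `v` one step
inwards. This yields a contraction of the augmented mod 2 chain complex, so the trace of `h` on
chains is zero. If no nonempty clique were stabilized, only the empty face would contribute and the
trace would be one. -/

/-- The basis vector of the mod 2 chain space of `K` at `s`, or `0` if `s` is not a face. -/
noncomputable def chainSingle (s : Finset V) : K →₀ ZMod 2 :=
  if hs : s ∈ K then Finsupp.single ⟨s, hs⟩ 1 else 0

/-- The linear endomorphism of the mod 2 chain space of `K` with given values on faces. -/
noncomputable def chainLift (f : Finset V → (K →₀ ZMod 2)) : Module.End (ZMod 2) (K →₀ ZMod 2) :=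
  Finsupp.linearCombination (ZMod 2) fun s : K => f s

/-- The mod 2 boundary operator. -/
noncomputable def chainBoundary : Module.End (ZMod 2) (K →₀ ZMod 2) :=
  chainLift K fun s => ∑ i ∈ s, chainSingle K (s.erase i)

/-- Coning each face `s` off to the vertex `c s`. -/
noncomputable def chainCone (c : Finset V → V) : Module.End (ZMod 2) (K →₀ ZMod 2) :=
  chainLift K fun s => if c s ∈ s then 0 else chainSingle K (insert (c s) s)

/-- The action of a permutation of the vertices on mod 2 chains. -/
noncomputable def chainMap (h : Equiv.Perm V) : Module.End (ZMod 2) (K →₀ ZMod 2) :=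
  chainLift K fun s => chainSingle K (s.map h.toEmbedding)

variable {K}

lemma chainSingle_coe (s : K) : chainSingle K s = Finsupp.single s 1 := by
  simp [chainSingle]

lemma chainSingle_apply (s : Finset V) (t : K) :
    chainSingle K s t = if s = t then 1 else 0 := by
  unfold chainSingle
  split_ifs with h1 h2 h2
  · subst h2; simp
  · rw [Finsupp.single_apply, if_neg (fun h => h2 (congrArg Subtype.val h))]
  · exact absurd (h2 ▸ t.2) h1
  · rfl

lemma chainLift_single (f : Finset V → (K →₀ ZMod 2)) {s : Finset V} (hs : s ∈ K) :
    chainLift K f (chainSingle K s) = f s := by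
  simp [chainLift, chainSingle, hs]

lemma chain_hom_ext {f g : Module.End (ZMod 2) (K →₀ ZMod 2)}
    (h : ∀ s ∈ K, f (chainSingle K s) = g (chainSingle K s)) : f = g := by
  refine Finsupp.lhom_ext' fun s => LinearMap.ext_ring ?_
  simpa [chainSingle_coe] using h s s.2

lemma chainBoundary_mul_self (hK : ∀ s ∈ K, ∀ t ⊆ s, t ∈ K) :
    chainBoundary K * chainBoundary K = 0 := by
  refine chain_hom_ext fun s hs => ?_
  rw [Module.End.mul_apply, LinearMap.zero_apply, chainBoundary, chainLift_single _ hs, map_sum,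
    Finset.sum_congr rfl fun i _ => chainLift_single _ (hK s hs _ (s.erase_subset i)),
    Finset.sum_sigma']
  refine Finset.sum_involution (fun p _ => ⟨p.2, p.1⟩) ?_ ?_ ?_ ?_
  · rintro ⟨i, j⟩ _
    simp only
    rw [Finset.erase_right_comm]
    exact ZModModule.add_self _
  · rintro ⟨i, j⟩ hij _ he
    simp only [Finset.mem_sigma, Finset.mem_erase] at hij
    simp only [Sigma.mk.injEq] at he
    exact hij.2.1 he.1
  · rintro ⟨i, j⟩ hij
    simp only [Finset.mem_sigma, Finset.mem_erase] at hij ⊢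
    exact ⟨hij.2.2, Ne.symm hij.2.1, hij.1⟩
  · rintro ⟨i, j⟩ _
    rfl

lemma chainBoundary_mul_chainMap (hK : ∀ s ∈ K, ∀ t ⊆ s, t ∈ K) {h : Equiv.Perm V}
    (hh : ∀ s ∈ K, s.map h.toEmbedding ∈ K) :
    chainBoundary K * chainMap K h = chainMap K h * chainBoundary K := by
  refine chain_hom_ext fun s hs => ?_
  rw [Module.End.mul_apply, Module.End.mul_apply, chainBoundary, chainMap, chainLift_single _ hs,
    chainLift_single _ hs, chainLift_single _ (hh s hs), map_sum, Finset.sum_map]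
  refine Finset.sum_congr rfl fun i _ => ?_
  rw [chainLift_single _ (hK s hs _ (s.erase_subset i)), Finset.map_erase]

lemma trace_chainMap (h : Equiv.Perm V) :
    LinearMap.trace (ZMod 2) (K →₀ ZMod 2) (chainMap K h) =
      ∑ s : K, if (s : Finset V).map h.toEmbedding = s then 1 else 0 := by
  rw [LinearMap.trace_eq_matrix_trace (ZMod 2) (Finsupp.basisSingleOne (ι := K)), Matrix.trace]
  refine Finset.sum_congr rfl fun s _ => ?_
  rw [Matrix.diag_apply, LinearMap.toMatrix_apply, Finsupp.basisSingleOne_repr,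
    Finsupp.coe_basisSingleOne]
  change chainMap K h (Finsupp.single s 1) s = _
  rw [← chainSingle_coe, chainMap, chainLift_single _ s.2]
  exact chainSingle_apply _ _

/-- The data of an acyclic matching `s ↔ s ∆ {c s}` on the faces of `K`, the empty one included. -/
structure IsConing {β : Type*} [LinearOrder β] (K : Finset (Finset V)) (c : Finset V → V)
    (wt : Finset V → β) : Prop where
  insert_mem : ∀ s ∈ K, insert (c s) s ∈ K
  erase_apex : ∀ s ∈ K, c s ∈ s → c (s.erase (c s)) = c s
  wt_insert : ∀ s ∈ K, wt (insert (c s) s) = wt s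
  erase : ∀ s ∈ K, ∀ i ∈ s, c (s.erase i) = c s ∨
    (wt (s.erase i) < wt s ∧ wt (insert (c s) (s.erase i)) < wt s)

variable {β : Type*} [LinearOrder β] {c : Finset V → V} {wt : Finset V → β}

lemma chainSingle_apply_of_lt {s : Finset V} {t : K} (h : wt s < wt t) : chainSingle K s t = 0 := by
  rw [chainSingle_apply, if_neg]
  rintro rfl
  exact h.false

/-- The operator is unitriangular for `wt`. Faces of `s` with the same apex contribute nothing, or
cancel in pairs mod 2; all others contribute only in weight below that of `s`. What survives is `s`,
recovered by removing and reinserting the apex in one order or the other. -/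
lemma IsConing.homotopy_apply (hK : ∀ s ∈ K, ∀ t ⊆ s, t ∈ K) (hc : IsConing K c wt) (s t : K)
    (hst : wt s ≤ wt t) :
    (chainBoundary K * chainCone K c + chainCone K c * chainBoundary K) (chainSingle K s) t =
      chainSingle K s t := by
  obtain ⟨s, hs⟩ := s
  simp only at hst ⊢
  have hmem : ∀ i, s.erase i ∈ K := fun i => hK s hs _ (s.erase_subset i)
  have hcone : ∀ {r}, r ∈ K → chainCone K c (chainSingle K r) =
      if c r ∈ r then 0 else chainSingle K (insert (c r) r) := fun hr => chainLift_single _ hr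
  have hlow : ∀ i, wt (s.erase i) < wt s → chainCone K c (chainSingle K (s.erase i)) t = 0 := by
    intro i hi
    rw [hcone (hmem i)]
    split_ifs
    · rfl
    · exact chainSingle_apply_of_lt ((hc.wt_insert _ (hmem i)).trans_lt (hi.trans_le hst))
  have hWD : chainCone K c (chainBoundary K (chainSingle K s)) =
      ∑ i ∈ s, chainCone K c (chainSingle K (s.erase i)) := by
    rw [chainBoundary, chainLift_single _ hs, map_sum]
  rw [LinearMap.add_apply, Module.End.mul_apply, Module.End.mul_apply, hWD, hcone hs]
  by_cases hcs : c s ∈ s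
  · rw [if_pos hcs, map_zero, zero_add, Finsupp.finsetSum_apply, Finset.sum_eq_single (c s)]
    · rw [hcone (hmem _), hc.erase_apex s hs hcs, if_neg (Finset.notMem_erase _ _),
        Finset.insert_erase hcs]
    · intro i hi hne
      rcases hc.erase s hs i hi with h | h
      · rw [hcone (hmem _), h, if_pos (Finset.mem_erase.2 ⟨hne.symm, hcs⟩)]
        rfl
      · exact hlow i h.1
    · exact fun h => absurd hcs h
  · rw [if_neg hcs, chainBoundary, chainLift_single _ (hc.insert_mem s hs),
      Finset.sum_insert hcs, Finset.erase_insert hcs, add_assoc, ← Finset.sum_add_distrib,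
      Finsupp.add_apply, Finsupp.finsetSum_apply, Finset.sum_eq_zero, add_zero]
    intro i hi
    have hne : c s ≠ i := fun h => hcs (h ▸ hi)
    rw [Finsupp.add_apply, Finset.erase_insert_of_ne hne]
    rcases hc.erase s hs i hi with h | h
    · rw [hcone (hmem _), h, if_neg (fun h' => hcs (Finset.mem_of_mem_erase h'))]
      exact CharTwo.add_self_eq_zero _
    · rw [hlow i h.1, chainSingle_apply_of_lt (h.2.trans_le hst), add_zero]

/-- By unitriangularity, a face of maximal weight in the support of a chain keeps its coefficient in
the image, so the kernel is trivial; the chain space is finite-dimensional. -/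
lemma IsConing.isUnit_homotopy (hK : ∀ s ∈ K, ∀ t ⊆ s, t ∈ K) (hc : IsConing K c wt) :
    IsUnit (chainBoundary K * chainCone K c + chainCone K c * chainBoundary K) := by
  rw [LinearMap.isUnit_iff_ker_eq_bot, LinearMap.ker_eq_bot']
  intro f hf
  by_contra hne
  obtain ⟨t, ht, hmax⟩ := f.support.exists_max_image (fun s : K => wt s)
    (Finsupp.support_nonempty_iff.2 hne)
  refine Finsupp.mem_support_iff.1 ht ?_
  have hsum : f = ∑ s ∈ f.support, f s • chainSingle K s := by
    conv_lhs => rw [← f.sum_single]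
    refine Finset.sum_congr rfl fun s _ => ?_
    rw [chainSingle_coe, Finsupp.smul_single, smul_eq_mul, mul_one]
  have h0 := DFunLike.congr_fun hf t
  rw [hsum, map_sum, Finsupp.finsetSum_apply] at h0
  rw [hsum, Finsupp.finsetSum_apply]
  rw [← Finsupp.zero_apply (M := ZMod 2) (a := t), ← h0]
  refine Finset.sum_congr rfl fun s hs => ?_
  rw [map_smul, Finsupp.smul_apply, Finsupp.smul_apply, hc.homotopy_apply hK s t (hmax s hs)]

/-- A mod 2 Lefschetz fixed point theorem: an automorphism of a finite complex that carries an
acyclic matching without critical faces stabilizes some nonempty face. -/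
theorem IsConing.exists_map_eq (hK : ∀ s ∈ K, ∀ t ⊆ s, t ∈ K) (hc : IsConing K c wt)
    (hempty : ∅ ∈ K) {h : Equiv.Perm V} (hh : ∀ s ∈ K, s.map h.toEmbedding ∈ K) :
    ∃ s ∈ K, s.Nonempty ∧ s.map h.toEmbedding = s := by
  by_contra! hno
  have htr : LinearMap.trace (ZMod 2) (K →₀ ZMod 2) (chainMap K h) = 1 := by
    rw [trace_chainMap, Finset.sum_eq_single ⟨∅, hempty⟩]
    · simp
    · intro s _ hs
      rw [if_neg]
      refine hno s s.2 (Finset.nonempty_iff_ne_empty.2 fun h0 => hs (Subtype.ext h0))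
    · simp
  obtain ⟨u, hu⟩ := hc.isUnit_homotopy hK
  set D := chainBoundary K
  set W := chainCone K c
  set P := chainMap K h
  set B : Module.End (ZMod 2) (K →₀ ZMod 2) := ↑u⁻¹
  have hDD : D * D = 0 := chainBoundary_mul_self hK
  have hDP : D * P = P * D := chainBoundary_mul_chainMap hK hh
  have hDu : D * u = u * D := by
    rw [hu, mul_add, add_mul, ← mul_assoc, hDD, zero_mul, zero_add, mul_assoc W, hDD, mul_zero,
      add_zero, mul_assoc]
  have hDB : B * D = D * B := by
    calc B * D = B * (D * u) * B := by rw [mul_assoc, mul_assoc, Units.mul_inv, mul_one]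
      _ = D * B := by rw [hDu, ← mul_assoc, Units.inv_mul, one_mul]
  -- Insert `1 = (D * W + W * D) * B`. As `D` commutes with `B` and `P`, the two terms have equal
  -- trace by cyclicity and cancel mod 2.
  have hP : P = P * D * W * B + P * W * B * D := by
    calc P = P * (u * B) := by rw [Units.mul_inv, mul_one]
      _ = _ := by rw [hu, mul_assoc (P * W), hDB]; noncomm_ring
  have h2 : LinearMap.trace (ZMod 2) (K →₀ ZMod 2) (P * W * B * D) =
      LinearMap.trace (ZMod 2) (K →₀ ZMod 2) (P * D * W * B) := by
    rw [LinearMap.trace_mul_comm, ← mul_assoc, ← mul_assoc, hDP]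
  rw [hP, map_add, h2, CharTwo.add_self_eq_zero] at htr
  exact zero_ne_one htr

end FixedFace

/-! ### Projections, convexity of balls and local finiteness. -/

namespace AbstractSimplicialComplex

variable {V : Type*} {X : AbstractSimplicialComplex V}

lemma vdist_comm (u v : V) : X.vdist u v = X.vdist v u := SimpleGraph.dist_comm

lemma vdist_self (u : V) : X.vdist u u = 0 := SimpleGraph.dist_self

lemma IsWeaklySystolic.vdist_triangle (hX : X.IsWeaklySystolic) (u v w : V) :
    X.vdist u w ≤ X.vdist u v + X.vdist v w := hX.connected.dist_triangle

lemma IsWeaklySystolic.vdist_eq_zero (hX : X.IsWeaklySystolic) {u v : V} :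
    X.vdist u v = 0 ↔ u = v := hX.connected.dist_eq_zero_iff

lemma vdist_eq_one {u v : V} : X.vdist u v = 1 ↔ X.oneSkeleton.Adj u v :=
  SimpleGraph.dist_eq_one_iff_adj

lemma IsWeaklySystolic.vdist_le_one (hX : X.IsWeaklySystolic) {u v : V} :
    X.vdist u v ≤ 1 ↔ u = v ∨ X.oneSkeleton.Adj u v := by
  rw [← hX.vdist_eq_zero, ← vdist_eq_one]
  omega

lemma IsWeaklySystolic.exists_adj_vdist_eq (hX : X.IsWeaklySystolic) {a b : V} {n : ℕ}
    (h : X.vdist a b = n + 1) : ∃ c, X.oneSkeleton.Adj a c ∧ X.vdist c b = n := by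
  obtain ⟨p, hp⟩ := hX.connected.exists_walk_length_eq_dist a b
  change p.length = X.vdist a b at hp
  cases p with
  | nil => simp [h] at hp
  | @cons _ c _ hac q =>
    refine ⟨c, hac, ?_⟩
    have h1 : X.vdist c b ≤ q.length := SimpleGraph.dist_le q
    have h2 := hX.vdist_triangle a c b
    rw [vdist_eq_one.2 hac] at h2
    rw [SimpleGraph.Walk.length_cons] at hp
    omega

lemma adj_of_mem {s : Finset V} (hs : s ∈ X) {u v : V} (hu : u ∈ s) (hv : v ∈ s) (huv : u ≠ v) :
    X.oneSkeleton.Adj u v := by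
  classical
  refine ⟨huv, {u, v}, (X.isRelLowerSet_faces hs).2 ?_ ⟨u, by simp⟩, by simp⟩
  intro x hx
  rcases Finset.mem_insert.1 hx with rfl | hx
  · exact hu
  · rwa [Finset.mem_singleton.1 hx]

/-- In a weakly systolic complex, the projection of a clique of a sphere to the next smaller ball
is a nonempty clique. -/
lemma IsWeaklySystolic.exists_projection (hX : X.IsWeaklySystolic) (v : V) (i : ℕ) {s : Finset V}
    (hne : s.Nonempty) (hs : (s : Set V).Pairwise X.oneSkeleton.Adj)
    (hd : ∀ u ∈ s, X.vdist v u = i + 1) :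
    (∃ g, X.vdist v g = i ∧ ∀ u ∈ s, X.oneSkeleton.Adj g u) ∧
      {w | X.vdist v w ≤ i ∧ ∀ u ∈ s, X.oneSkeleton.Adj w u}.Pairwise X.oneSkeleton.Adj := by
  classical
  have hsX : s ∈ X := hX.flag s hne fun u hu w hw huw => hs hu hw huw
  obtain ⟨r, hr, hrs⟩ := hX.sd v i i le_rfl s hsX hd
  have hmem : ∀ w, w ∈ r ↔ {w} ∈ X.link s ∧ X.vdist v w ≤ i := fun w => by
    rw [← Finset.mem_coe, hrs]; rfl
  constructor
  · obtain ⟨g, hg⟩ := (X.isRelLowerSet_faces hr).1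
    obtain ⟨⟨_, hdisj, hgs⟩, hgi⟩ := (hmem g).1 hg
    have hgs' : ∀ u ∈ s, X.oneSkeleton.Adj g u := fun u hu =>
      adj_of_mem (X := X) hgs (Finset.mem_union_left _ (Finset.mem_singleton_self g))
        (Finset.mem_union_right _ (by convert hu))
        (fun h => Finset.disjoint_singleton_left.1 hdisj (h ▸ hu))
    refine ⟨g, ?_, hgs'⟩
    obtain ⟨u, hu⟩ := hne
    have := hX.vdist_triangle v g u
    rw [hd u hu, vdist_eq_one.2 (hgs' u hu)] at this
    omega
  · have hr' : ∀ w, X.vdist v w ≤ i → (∀ u ∈ s, X.oneSkeleton.Adj w u) → w ∈ r := by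
      intro w hw hws
      refine (hmem w).2 ⟨⟨X.singleton_mem w, ?_, ?_⟩, hw⟩
      · exact Finset.disjoint_singleton_left.2 fun h => (hws w h).ne rfl
      · refine hX.flag _ ⟨w, by simp⟩ ?_
        intro a ha b hb hab
        simp only [Finset.mem_union, Finset.mem_singleton] at ha hb
        rcases ha with rfl | ha <;> rcases hb with rfl | hb
        · exact absurd rfl hab
        · exact hws _ hb
        · exact (hws _ ha).symm
        · exact hs ha hb hab
    exact fun a ha b hb hab => adj_of_mem hr (hr' a ha.1 ha.2) (hr' b hb.1 hb.2) hab

/-- Both vertices lie in the clique to which the simplex `{x}` projects. -/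
lemma IsWeaklySystolic.vdist_le_one_of_adj (hX : X.IsWeaklySystolic) {v x a b : V} {i : ℕ}
    (hx : X.vdist v x = i + 1) (ha : X.vdist v a ≤ i) (hb : X.vdist v b ≤ i)
    (hax : X.oneSkeleton.Adj a x) (hbx : X.oneSkeleton.Adj b x) : X.vdist a b ≤ 1 := by
  have h := (hX.exists_projection v i (s := {x}) ⟨x, by simp⟩ (by simp) (by simpa using hx)).2
  rw [hX.vdist_le_one]
  by_contra! hab
  exact hab.2 (h ⟨ha, by simpa using hax⟩ ⟨hb, by simpa using hbx⟩ hab.1)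

/-- Balls of a weakly systolic complex are geodesically convex. -/
theorem IsWeaklySystolic.vdist_le_of_between (hX : X.IsWeaklySystolic) (o : V) {n : ℕ} :
    ∀ {a b w : V} {R : ℕ}, X.vdist a b = n → X.vdist a w + X.vdist w b = n →
      X.vdist o a ≤ R → X.vdist o b ≤ R → X.vdist o w ≤ R := by
  induction n using Nat.strong_induction_on with
  | _ n ih =>
  intro a b w R hab hw ha hb
  obtain haw | ⟨m, haw⟩ : X.vdist a w = 0 ∨ ∃ m, X.vdist a w = m + 1 := by
    cases X.vdist a w <;> simp
  · rwa [← hX.vdist_eq_zero.1 haw]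
  obtain ⟨x, hax, hxw⟩ := hX.exists_adj_vdist_eq haw
  have hax1 := vdist_eq_one.2 hax
  have t1 := hX.vdist_triangle a x b
  have t2 := hX.vdist_triangle x w b
  have hxb : X.vdist x b = n - 1 := by omega
  -- Only the first step `x` from `a` towards `w` matters; the rest is the induction hypothesis for
  -- the shorter pair `x`, `b`.
  suffices hx : X.vdist o x ≤ R from ih (n - 1) (by omega) hxb (by omega) hx hb
  by_contra hx
  have t3 := hX.vdist_triangle o a x
  have hx' : X.vdist o x = R + 1 := by omega
  have hn : n - 1 ≠ 0 := fun h0 => hx (by rwa [hX.vdist_eq_zero.1 (hxb.trans h0)])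
  obtain ⟨y, hxy, hyb⟩ := hX.exists_adj_vdist_eq (hxb.trans (by omega : n - 1 = (n - 2) + 1))
  have hxy1 := vdist_eq_one.2 hxy
  have hay : 2 ≤ X.vdist a y := by
    have := hX.vdist_triangle a y b
    omega
  have hyR : X.vdist o y ≤ R + 1 :=
    ih (n - 1) (by omega) hxb (by omega) hx'.le (by omega)
  -- Otherwise `a` and `y` both project from `x`, hence are at distance at most one, although they
  -- are two steps apart on a geodesic.
  have hyR' : X.vdist o y = R + 1 := by
    by_contra h
    have := hX.vdist_le_one_of_adj hx' ha (by omega : X.vdist o y ≤ R) hax hxy.symm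
    omega
  classical
  -- The edge `x y` of the sphere projects to `z` in the ball. Then `z` is within one of `a`, so `y`
  -- lies on a geodesic from `z` to `b`, and induction puts `y` in the ball: a contradiction.
  obtain ⟨⟨z, hz, hzs⟩, -⟩ := hX.exists_projection o R (s := {x, y}) ⟨x, by simp⟩
    (by
      rw [Finset.coe_pair, Set.pairwise_pair]
      exact fun _ => ⟨hxy, hxy.symm⟩) (by simp [hx', hyR'])
  have hzx := hzs x (by simp)
  have hzy1 := vdist_eq_one.2 (hzs y (by simp))
  have haz := hX.vdist_le_one_of_adj hx' ha hz.le hax hzx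
  have t4 := hX.vdist_triangle a z b
  have t5 := hX.vdist_triangle z y b
  have := ih (n - 1) (by omega) (by omega : X.vdist z b = n - 1)
    (by omega : X.vdist z y + X.vdist y b = n - 1) hz.le hb
  omega

lemma IsUniformlyLocallyFinite.finite_ball (hX : X.IsWeaklySystolic)
    (hfin : X.IsUniformlyLocallyFinite) (o : V) (R : ℕ) : {u | X.vdist u o ≤ R}.Finite := by
  classical
  obtain ⟨N, hN⟩ := hfin
  have hnbr : ∀ c, {u | X.oneSkeleton.Adj u c}.Finite := fun c => by
    have hf : {s : Finset V | s ∈ X ∧ c ∈ s}.Finite :=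
      Set.finite_of_encard_le_coe (hN c)
    refine (hf.biUnion fun s _ => s.finite_toSet).subset fun u hu => ?_
    obtain ⟨-, s, hs, hsu⟩ := hu
    have hmem : ∀ x, x ∈ s ↔ x = u ∨ x = c := fun x => by rw [← Finset.mem_coe, hsu]; simp
    exact Set.mem_biUnion ⟨hs, (hmem c).2 (.inr rfl)⟩ (Finset.mem_coe.2 ((hmem u).2 (.inl rfl)))
  induction R with
  | zero =>
    refine (Set.finite_singleton o).subset fun u hu => ?_
    exact hX.vdist_eq_zero.1 (Nat.le_zero.1 hu)
  | succ R ih =>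
    refine (ih.union (ih.biUnion fun c _ => hnbr c)).subset fun u hu => ?_
    rcases Nat.lt_or_ge R (X.vdist u o) with h | h
    · obtain ⟨c, huc, hc⟩ := hX.exists_adj_vdist_eq (le_antisymm hu h)
      exact .inr (Set.mem_biUnion (show X.vdist c o ≤ R from hc.le) huc)
    · exact .inl h

end AbstractSimplicialComplex

/-! ### The part of a finite set where a function is maximal. -/

section TopPart

variable {V : Type*} (f : V → ℕ)

/-- The elements of `s` at which `f` attains its maximum over `s`. -/
def topPart (s : Finset V) : Finset V := s.filter fun x => f x = s.sup f

variable {f}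

lemma mem_topPart {s : Finset V} {x : V} : x ∈ topPart f s ↔ x ∈ s ∧ f x = s.sup f :=
  Finset.mem_filter

lemma topPart_nonempty {s : Finset V} (hs : s.Nonempty) : (topPart f s).Nonempty := by
  obtain ⟨x, hx, h⟩ := Finset.exists_mem_eq_sup s hs f
  exact ⟨x, mem_topPart.2 ⟨hx, h.symm⟩⟩

variable [DecidableEq V]

lemma sup_insert_of_lt {s : Finset V} {x : V} (hx : f x < s.sup f) :
    (insert x s).sup f = s.sup f := by
  rw [Finset.sup_insert, max_eq_right hx.le]

lemma topPart_insert_of_lt {s : Finset V} {x : V} (hx : f x < s.sup f) :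
    topPart f (insert x s) = topPart f s := by
  rw [topPart, sup_insert_of_lt hx, Finset.filter_insert, if_neg hx.ne, topPart]

lemma sup_erase_of_lt {s : Finset V} {x : V} (hx : f x < s.sup f) :
    (s.erase x).sup f = s.sup f := by
  by_cases hxs : x ∈ s
  · have h := Finset.sup_insert (f := f) (b := x) (s := s.erase x)
    rw [Finset.insert_erase hxs] at h
    have : s.sup f = max (f x) ((s.erase x).sup f) := h
    omega
  · rw [Finset.erase_eq_of_notMem hxs]

lemma topPart_erase_of_lt {s : Finset V} {x : V} (hx : f x < s.sup f) :
    topPart f (s.erase x) = topPart f s := by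
  by_cases hxs : x ∈ s
  · conv_rhs => rw [← Finset.insert_erase hxs]
    exact (topPart_insert_of_lt (hx.trans_eq (sup_erase_of_lt hx).symm)).symm
  · rw [Finset.erase_eq_of_notMem hxs]

lemma card_topPart_erase_lt {s : Finset V} {x : V} (hx : x ∈ topPart f s)
    (h : (s.erase x).sup f = s.sup f) : (topPart f (s.erase x)).card < (topPart f s).card := by
  refine Finset.card_lt_card ⟨fun y hy => ?_, fun hsub => ?_⟩
  · rw [mem_topPart, h] at hy
    exact mem_topPart.2 ⟨Finset.mem_of_mem_erase hy.1, hy.2⟩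
  · exact Finset.notMem_erase x s (mem_topPart.1 (hsub hx)).1

end TopPart

/-! ### Coning of cliques and the stabilized simplex. -/

namespace AbstractSimplicialComplex

variable {V : Type*} {X : AbstractSimplicialComplex V}

/-- The cliques inside a finite set that is closed under geodesics from `v` carry an acyclic
matching without critical faces. -/
lemma IsWeaklySystolic.exists_isConing [DecidableEq V] (hX : X.IsWeaklySystolic) {Y : Finset V}
    {v : V} (hv : v ∈ Y)
    (hY : ∀ u ∈ Y, ∀ w, X.vdist v w + X.vdist w u = X.vdist v u → w ∈ Y)
    {K : Finset (Finset V)}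
    (hK : ∀ s, s ∈ K ↔ s ⊆ Y ∧ (s : Set V).Pairwise X.oneSkeleton.Adj) :
    ∃ (c : Finset V → V) (wt : Finset V → ℕ ×ₗ ℕ), IsConing K c wt := by
  -- The point is chosen before the radius `i`, so that the apex depends only on the top part.
  have hproj : ∀ t : Finset V, ∃ g, ∀ i, t.Nonempty → (t : Set V).Pairwise X.oneSkeleton.Adj →
      (∀ u ∈ t, X.vdist v u = i + 1) →
      X.vdist v g = i ∧ ∀ u ∈ t, X.oneSkeleton.Adj g u := by
    intro t
    by_cases h : t.Nonempty ∧ (t : Set V).Pairwise X.oneSkeleton.Adj ∧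
      ∃ i, ∀ u ∈ t, X.vdist v u = i + 1
    · obtain ⟨⟨x, hx⟩, hadj, i, hi⟩ := h
      obtain ⟨⟨g, hg, hgt⟩, -⟩ := hX.exists_projection v i ⟨x, hx⟩ hadj hi
      refine ⟨g, fun j _ _ hj => ⟨?_, hgt⟩⟩
      have := hi x hx
      have := hj x hx
      omega
    · exact ⟨v, fun i h1 h2 h3 => absurd ⟨h1, h2, i, h3⟩ h⟩
  choose g hg using hproj
  set f : V → ℕ := X.vdist v with hf
  set c : Finset V → V := fun s => if s.sup f = 0 then v else g (topPart f s) with hc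
  -- The second entry is `0` at level zero because `∅` and `{v}` are matched and must have equal
  -- weight.
  set wt : Finset V → ℕ ×ₗ ℕ := fun s =>
    toLex (s.sup f, if s.sup f = 0 then 0 else (topPart f s).card) with hwt
  have hfv : f v = 0 := vdist_self v
  have hc_congr : ∀ {s t : Finset V}, s.sup f = t.sup f → topPart f s = topPart f t →
      c s = c t := fun h1 h2 => by simp only [hc, h1, h2]
  have hwt_congr : ∀ {s t : Finset V}, s.sup f = t.sup f → topPart f s = topPart f t →
      wt s = wt t := fun h1 h2 => by simp only [hwt, h1, h2]
  have hzero : ∀ {s : Finset V}, s.sup f = 0 → c s = v := fun h => if_pos h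
  have hzero_sub : ∀ {s : Finset V}, s.sup f = 0 → s ⊆ {v} := by
    intro s h x hx
    have h1 : f x ≤ s.sup f := Finset.le_sup hx
    rw [Finset.mem_singleton]
    exact (hX.vdist_eq_zero.1 (Nat.le_zero.1 (h ▸ h1))).symm
  -- The apex lies on a geodesic from `v` to a top vertex, hence in `Y`. The lower vertices of `s`
  -- are adjacent to the whole top part, so they belong with the apex to the projection clique.
  have happex : ∀ s ∈ K, s.sup f ≠ 0 → f (c s) < s.sup f ∧ insert (c s) s ∈ K := by
    intro s hs h0
    obtain ⟨hsY, hadj⟩ := (hK s).1 hs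
    have hne : s.Nonempty := by
      rw [Finset.nonempty_iff_ne_empty]
      rintro rfl
      exact h0 rfl
    obtain ⟨k, hk⟩ := Nat.exists_eq_succ_of_ne_zero h0
    have hadj' : (topPart f s : Set V).Pairwise X.oneSkeleton.Adj :=
      hadj.mono (Finset.coe_subset.2 (Finset.filter_subset _ _))
    have hlev : ∀ u ∈ topPart f s, X.vdist v u = k + 1 := fun u hu =>
      (mem_topPart.1 hu).2.trans hk
    obtain ⟨hgk, hgadj⟩ := hg (topPart f s) k (topPart_nonempty hne) hadj' hlev
    have hcs : c s = g (topPart f s) := if_neg h0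
    rw [← hcs] at hgk hgadj
    refine ⟨by rw [hk]; exact hgk.trans_lt (Nat.lt_succ_self k), (hK _).2 ⟨?_, ?_⟩⟩
    · obtain ⟨u, hu⟩ := topPart_nonempty (f := f) hne
      refine Finset.insert_subset (hY u (hsY (mem_topPart.1 hu).1) _ ?_) hsY
      rw [vdist_eq_one.2 (hgadj u hu)]
      exact (congrArg (· + 1) hgk).trans (hlev u hu).symm
    · rw [Finset.coe_insert]
      have := X.oneSkeleton.symm
      refine hadj.insert_of_symm fun w hw hcw => ?_
      by_cases hwt : w ∈ topPart f s
      · exact hgadj w hwt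
      · have h1 : f w ≤ s.sup f := Finset.le_sup hw
        have h2 : f w ≠ s.sup f := fun h => hwt (mem_topPart.2 ⟨hw, h⟩)
        refine (hX.exists_projection v k (topPart_nonempty hne) hadj' hlev).2 ⟨hgk.le, hgadj⟩
          ⟨?_, fun u hu => ?_⟩ hcw
        · change f w ≤ k
          omega
        · exact hadj hw (mem_topPart.1 hu).1 fun h => hwt (h ▸ hu)
  refine ⟨c, wt, ⟨?_, ?_, ?_, ?_⟩⟩
  · intro s hs
    by_cases h0 : s.sup f = 0
    · rw [hzero h0, hK]
      have hsub : insert v s ⊆ {v} := Finset.insert_subset (by simp) (hzero_sub h0)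
      refine ⟨hsub.trans (by simpa using hv), ?_⟩
      exact (Set.pairwise_singleton v _).mono (by simpa using Finset.coe_subset.2 hsub)
    · exact (happex s hs h0).2
  · intro s hs _
    by_cases h0 : s.sup f = 0
    · have h1 : (s.erase (c s)).sup f = 0 :=
        Nat.le_zero.1 ((Finset.sup_mono (Finset.erase_subset _ _)).trans h0.le)
      rw [hzero h1, hzero h0]
    · have h1 := (happex s hs h0).1
      exact hc_congr (sup_erase_of_lt h1) (topPart_erase_of_lt h1)
  · intro s hs
    by_cases h0 : s.sup f = 0
    · have h1 : (insert (c s) s).sup f = 0 := by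
        rw [hzero h0, Finset.sup_insert, hfv, h0]; rfl
      simp only [hwt]
      rw [if_pos h1, if_pos h0, h1, h0]
    · have h1 := (happex s hs h0).1
      exact hwt_congr (sup_insert_of_lt h1) (topPart_insert_of_lt h1)
  · intro s hs i hi
    have hle : (s.erase i).sup f ≤ s.sup f := Finset.sup_mono (Finset.erase_subset _ _)
    by_cases h0 : s.sup f = 0
    · left
      rw [hzero h0, hzero (Nat.le_zero.1 (hle.trans h0.le))]
    · obtain ⟨hcs, -⟩ := happex s hs h0
      by_cases hit : i ∈ topPart f s
      · right
        rcases hle.lt_or_eq with hlt | heq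
        · refine ⟨Prod.Lex.toLex_lt_toLex.2 (.inl hlt), Prod.Lex.toLex_lt_toLex.2 (.inl ?_)⟩
          simp only
          rw [Finset.sup_insert]
          exact max_lt hcs hlt
        · have h1 : wt (s.erase i) < wt s := by
            refine Prod.Lex.toLex_lt_toLex.2 (.inr ⟨heq, ?_⟩)
            simp only
            rw [if_neg h0, if_neg (heq.trans_ne h0)]
            exact card_topPart_erase_lt hit heq
          have hcs' := hcs.trans_eq heq.symm
          refine ⟨h1, ?_⟩
          rwa [hwt_congr (sup_insert_of_lt hcs') (topPart_insert_of_lt hcs')]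
      · left
        have h1 : f i ≤ s.sup f := Finset.le_sup hi
        have h2 : f i < s.sup f := lt_of_le_of_ne h1 fun h => hit (mem_topPart.2 ⟨hi, h⟩)
        exact hc_congr (sup_erase_of_lt h2) (topPart_erase_of_lt h2)

lemma IsSimplicialIsometry.adj_map {h : Equiv.Perm V} (hh : X.IsSimplicialIsometry h) {u v : V} :
    X.oneSkeleton.Adj (h u) (h v) ↔ X.oneSkeleton.Adj u v := by
  rw [← vdist_eq_one, hh.vdist_map, vdist_eq_one]

lemma IsSimplicialIsometry.vdist_pow {h : Equiv.Perm V} (hh : X.IsSimplicialIsometry h) (k : ℕ)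
    (u v : V) : X.vdist ((h ^ k) u) ((h ^ k) v) = X.vdist u v := by
  induction k with
  | zero => simp
  | succ k ih => rw [pow_succ', Equiv.Perm.mul_apply, Equiv.Perm.mul_apply, hh.vdist_map, ih]

/-- A simplicial isometry of a locally finite weakly systolic complex with a periodic vertex
stabilizes a simplex. -/
theorem IsWeaklySystolic.exists_map_eq_of_periodic (hX : X.IsWeaklySystolic)
    (hfin : X.IsUniformlyLocallyFinite) {h : Equiv.Perm V} (hh : X.IsSimplicialIsometry h)
    {m : ℕ} (hm : 1 ≤ m) {v : V} (hv : (h ^ m) v = v) :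
    ∃ s ∈ X, s.map h.toEmbedding = s := by
  classical
  have hmod : ∀ k, (h ^ k) v = (h ^ (k % m)) v := fun k => by
    have : Function.IsPeriodicPt h m v := by rwa [Equiv.Perm.coe_pow] at hv
    rw [Equiv.Perm.coe_pow, Equiv.Perm.coe_pow, this.iterate_mod_apply]
  -- This sum bounds the distance from `v` to every point of its orbit, so that `v ∈ S`.
  set R := ∑ j ∈ Finset.range m, X.vdist ((h ^ j) v) v with hR
  set S : Set V := {u | ∀ k, X.vdist ((h ^ k) v) u ≤ R} with hS
  have hSfin : S.Finite := by
    refine (hfin.finite_ball hX v R).subset fun u hu => ?_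
    change X.vdist u v ≤ R
    rw [vdist_comm]
    exact hu 0
  have hvS : v ∈ S := fun k => by
    rw [hmod]
    exact Finset.single_le_sum (f := fun j => X.vdist ((h ^ j) v) v) (fun _ _ => Nat.zero_le _)
      (Finset.mem_range.2 (Nat.mod_lt _ hm))
  have hhS : ∀ u ∈ S, h u ∈ S := by
    intro u hu k
    -- Periodicity replaces the exponent `k - 1` by `k + m - 1`, which is meaningful also for `k =
    -- 0`.
    have : (h ^ k) v = h ((h ^ (k + m - 1)) v) := by
      rw [← Equiv.Perm.mul_apply, ← pow_succ', show k + m - 1 + 1 = k + m by omega, pow_add,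
        Equiv.Perm.mul_apply, hv]
    rw [this, hh.vdist_map]
    exact hu _
  set Y := hSfin.toFinset
  have hYS : ∀ u, u ∈ Y ↔ u ∈ S := fun u => hSfin.mem_toFinset
  set K := Y.powerset.filter fun s : Finset V => (s : Set V).Pairwise X.oneSkeleton.Adj with hKdef
  have hK : ∀ s, s ∈ K ↔ s ⊆ Y ∧ (s : Set V).Pairwise X.oneSkeleton.Adj := fun s => by
    rw [hKdef, Finset.mem_filter, Finset.mem_powerset]
  obtain ⟨c, wt, hc⟩ := hX.exists_isConing ((hYS v).2 hvS) (fun u hu w hw => (hYS w).2 fun k =>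
    hX.vdist_le_of_between _ rfl hw (hvS k) ((hYS u).1 hu k)) hK
  obtain ⟨s, hs, hne, hmap⟩ := hc.exists_map_eq
    (fun s hs t ht => (hK t).2 ⟨ht.trans ((hK s).1 hs).1,
      ((hK s).1 hs).2.mono (Finset.coe_subset.2 ht)⟩) ((hK ∅).2 (by simp)) (h := h)
    (fun s hs => by
      obtain ⟨h1, h2⟩ := (hK s).1 hs
      refine (hK _).2 ⟨fun x hx => ?_, ?_⟩
      · obtain ⟨y, hy, rfl⟩ := Finset.mem_map.1 hx
        exact (hYS _).2 (hhS y ((hYS y).1 (h1 hy)))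
      · rw [Finset.coe_map]
        rintro _ ⟨a, ha, rfl⟩ _ ⟨b, hb, rfl⟩ hab
        exact hh.adj_map.2 (h2 ha hb fun e => hab (e ▸ rfl)))
  exact ⟨s, hX.flag s hne fun u hu w hw huw => ((hK s).1 hs).2 hu hw huw, hmap⟩

end AbstractSimplicialComplex

/-! ### Linear displacement and invariant geodesics. -/

namespace AbstractSimplicialComplex

variable {V : Type*} {X : AbstractSimplicialComplex V}

/-- The path is constant after time `L`, hence the bound `≤ 1` at every step. -/
lemma IsWeaklySystolic.exists_path (hX : X.IsWeaklySystolic) {L : ℕ} {a b : V}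
    (hab : X.vdist a b = L) :
    ∃ p : ℕ → V, p 0 = a ∧ p L = b ∧ ∀ i, X.vdist (p i) (p (i + 1)) ≤ 1 := by
  induction L generalizing a with
  | zero => exact ⟨fun _ => a, rfl, hX.vdist_eq_zero.1 hab, fun _ => by simp [vdist_self]⟩
  | succ L ih =>
    obtain ⟨c, hac, hcb⟩ := hX.exists_adj_vdist_eq hab
    obtain ⟨p, hp0, hpL, hp⟩ := ih hcb
    refine ⟨fun i => Nat.casesOn i a p, rfl, hpL, fun i => ?_⟩
    cases i with
    | zero => exact (hp0 ▸ vdist_eq_one.2 hac).le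
    | succ i => exact hp i

lemma vdist_zpow {g : Equiv.Perm V} (hg : ∀ u v, X.vdist (g u) (g v) = X.vdist u v) (z : ℤ)
    (u v : V) : X.vdist ((g ^ z) u) ((g ^ z) v) = X.vdist u v := by
  induction z using Int.induction_on generalizing u v with
  | zero => simp
  | succ k ih => rw [zpow_add_one, Equiv.Perm.mul_apply, Equiv.Perm.mul_apply, ih, hg]
  | pred k ih =>
    rw [zpow_sub_one, Equiv.Perm.mul_apply, Equiv.Perm.mul_apply, ih, ← hg,
      ← Equiv.Perm.mul_apply, ← Equiv.Perm.mul_apply, mul_inv_cancel, Equiv.Perm.one_apply,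
      Equiv.Perm.one_apply]

/-- Concatenating the translates of a shortest path from `x` to `g x` gives a `g`-invariant
geodesic, provided that `g` displaces `x` linearly. -/
lemma IsWeaklySystolic.exists_isInvariantGeodesic (hX : X.IsWeaklySystolic) {g : Equiv.Perm V}
    (hg : ∀ u v, X.vdist (g u) (g v) = X.vdist u v) {x : V} {L : ℕ} (hL : 0 < L)
    (hx : ∀ k : ℕ, X.vdist x ((g ^ k) x) = k * L) :
    ∃ γ : ℤ → V, X.IsInvariantGeodesic g γ ∧ x ∈ Set.range γ := by
  obtain ⟨p, hp0, hpL, hp⟩ := hX.exists_path (by simpa using hx 1 : X.vdist x (g x) = L)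
  set γ : ℤ → V := fun k => (g ^ (k / L)) (p (k % L).toNat) with hγdef
  have hlt : ∀ (q : ℤ) (r : ℕ), r < L → γ (L * q + r) = (g ^ q) (p r) := by
    intro q r hr
    obtain ⟨h1, h2⟩ := (Int.ediv_emod_unique (a := L * q + r) (b := L) (r := r) (q := q)
      (by exact_mod_cast hL)).2 ⟨by ring, by positivity, by exact_mod_cast hr⟩
    simp only [hγdef, h1, h2, Int.toNat_natCast]
  have hmul : ∀ q : ℤ, γ (L * q) = (g ^ q) x := fun q => by
    simpa [hp0] using hlt q 0 hL
  -- The value `r = L` is allowed because consecutive translates of the path meet: `p L = g x`.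
  have hle : ∀ (q : ℤ) (r : ℕ), r ≤ L → γ (L * q + r) = (g ^ q) (p r) := by
    intro q r hr
    rcases hr.lt_or_eq with hr | rfl
    · exact hlt q r hr
    · rw [hpL, ← Equiv.Perm.mul_apply, ← zpow_add_one, ← hmul, mul_add, mul_one]
  have hdecomp : ∀ k : ℤ, ∃ (q : ℤ) (r : ℕ), r < L ∧ k = L * q + r := fun k => by
    have h0 : (0 : ℤ) < L := by exact_mod_cast hL
    have h1 := Int.emod_nonneg k h0.ne'
    have h2 := Int.emod_lt_of_pos k h0
    refine ⟨k / L, (k % L).toNat, by omega, ?_⟩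
    rw [Int.toNat_of_nonneg h1, Int.mul_ediv_add_emod]
  have hstep : ∀ k, X.vdist (γ k) (γ (k + 1)) ≤ 1 := by
    intro k
    obtain ⟨q, r, hr, rfl⟩ := hdecomp k
    have := hle q (r + 1) hr
    rw [Nat.cast_add, Nat.cast_one, ← add_assoc] at this
    rw [this, hle q r hr.le, vdist_zpow hg]
    exact hp r
  have hlip : ∀ (n : ℕ) (k : ℤ), X.vdist (γ k) (γ (k + n)) ≤ n := by
    intro n k
    induction n with
    | zero => simp [vdist_self]
    | succ n ih =>
      have h1 := hX.vdist_triangle (γ k) (γ (k + n)) (γ (k + n + 1))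
      have h2 := hstep (k + n)
      rw [Nat.cast_add, Nat.cast_one, ← add_assoc]
      omega
  have hfar : ∀ q : ℕ, X.vdist (γ (L * (-q : ℤ))) (γ (L * (q : ℤ))) = 2 * (q * L) := by
    intro q
    rw [hmul, hmul, ← vdist_zpow hg q, ← Equiv.Perm.mul_apply, ← Equiv.Perm.mul_apply,
      ← zpow_add, ← zpow_add, add_neg_cancel, zpow_zero, Equiv.Perm.one_apply, ← Nat.cast_add,
      zpow_natCast, hx]
    ring
  have hgeo : ∀ (n : ℕ) (k : ℤ), X.vdist (γ k) (γ (k + n)) = n := by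
    intro n k
    refine le_antisymm (hlip n k) ?_
    -- The interval from `k` to `k + n` then lies between `-q * L` and `q * L`. The distance between
    -- those ends is the full length of `γ`, so the 1-Lipschitz map `γ` loses nothing in between.
    set q : ℕ := k.natAbs + n
    have hq : (q : ℤ) ≤ q * L := by
      exact_mod_cast Nat.le_mul_of_pos_right q hL
    obtain ⟨a, ha⟩ := Int.eq_ofNat_of_zero_le (by omega : 0 ≤ k + q * L)
    obtain ⟨b, hb⟩ := Int.eq_ofNat_of_zero_le (by omega : 0 ≤ q * L - (k + n))
    have h1 := hlip a (L * (-q : ℤ))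
    rw [show (L * (-q : ℤ)) + a = k by rw [← ha]; ring] at h1
    have h2 := hlip b (k + n)
    rw [show k + n + (b : ℤ) = L * (q : ℤ) by rw [← hb]; ring] at h2
    have h3 := hfar q
    have h4 := hX.vdist_triangle (γ (L * (-q : ℤ))) (γ k) (γ (L * (q : ℤ)))
    have h5 := hX.vdist_triangle (γ k) (γ (k + n)) (γ (L * (q : ℤ)))
    zify at *
    omega
  have hshift : ∀ k, g (γ k) = γ (k + L) := by
    intro k
    obtain ⟨q, r, hr, rfl⟩ := hdecomp k
    rw [show (L * q + r + L : ℤ) = L * (1 + q) + r by ring, hle _ _ hr.le, hle _ _ hr.le,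
      zpow_one_add, Equiv.Perm.mul_apply]
  refine ⟨γ, ⟨fun a b => ?_, ?_⟩, 0, ?_⟩
  · rcases le_total a b with h | h
    · obtain ⟨n, rfl⟩ := Int.le.dest h
      rw [hgeo]
      omega
    · obtain ⟨n, rfl⟩ := Int.le.dest h
      rw [vdist_comm, hgeo]
      omega
  · ext y
    constructor
    · rintro ⟨_, ⟨k, rfl⟩, rfl⟩
      exact ⟨k + L, (hshift k).symm⟩
    · rintro ⟨k, rfl⟩
      exact ⟨_, ⟨k - L, rfl⟩, by rw [hshift, sub_add_cancel]⟩
  · simpa using hmul 0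

/-- An isometry preserving a geodesic translates it, unless its square fixes a vertex. -/
lemma IsInvariantGeodesic.exists_translation {g : Equiv.Perm V}
    (hg : ∀ u v, X.vdist (g u) (g v) = X.vdist u v) {γ : ℤ → V} (hγ : X.IsInvariantGeodesic g γ)
    (hfix : ∀ v, (g ^ 2) v ≠ v) : ∃ t : ℤ, t ≠ 0 ∧ ∀ k, g (γ k) = γ (k + t) := by
  obtain ⟨hgeo, hinv⟩ := hγ
  have hex : ∀ k, ∃ j, γ j = g (γ k) := fun k => by
    have : g (γ k) ∈ Set.range γ := hinv ▸ Set.mem_image_of_mem g ⟨k, rfl⟩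
    exact this
  choose φ hφ using hex
  have hiso : ∀ a b, (φ a - φ b).natAbs = (a - b).natAbs := fun a b => by
    rw [← hgeo, hφ, hφ, hg, hgeo]
  by_cases h1 : φ 1 = φ 0 + 1
  · have h : ∀ k, φ k = k + φ 0 := fun k => by
      have := hiso k 0
      have := hiso k 1
      omega
    refine ⟨φ 0, fun h0 => hfix (γ 0) ?_, fun k => by rw [← h, hφ]⟩
    rw [sq, Equiv.Perm.mul_apply, ← hφ, h0, ← hφ, h0]
  -- The remaining isometries of `ℤ` are the reflections `k ↦ φ 0 - k`, whose square is the
  -- identity.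
  · have h : φ (φ 0) = 0 := by
      have := hiso 1 0
      have := hiso (φ 0) 0
      have := hiso (φ 0) 1
      omega
    refine absurd ?_ (hfix (γ 0))
    rw [sq, Equiv.Perm.mul_apply, ← hφ, ← hφ, h]

lemma IsWeaklySystolic.vdist_pow_le_mul (hX : X.IsWeaklySystolic) {g : Equiv.Perm V}
    (hg : ∀ u v, X.vdist (g u) (g v) = X.vdist u v) (x : V) (k : ℕ) :
    X.vdist x ((g ^ k) x) ≤ k * X.vdist x (g x) := by
  induction k with
  | zero => simp [vdist_self]
  | succ k ih =>
    have h1 := hX.vdist_triangle x (g x) ((g ^ (k + 1)) x)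
    rw [pow_succ', Equiv.Perm.mul_apply, hg] at h1
    rw [pow_succ', Equiv.Perm.mul_apply, add_mul]
    omega

/-- If some vertex is displaced linearly at rate `L`, then so is every vertex that is displaced
by at most `L`. -/
lemma IsWeaklySystolic.vdist_pow_eq_mul (hX : X.IsWeaklySystolic) {g : Equiv.Perm V}
    (hg : ∀ u v, X.vdist (g u) (g v) = X.vdist u v) {x y : V} {L : ℕ}
    (hy : ∀ k : ℕ, X.vdist y ((g ^ k) y) = k * L) (hx : X.vdist x (g x) ≤ L) (k : ℕ) :
    X.vdist x ((g ^ k) x) = k * L := by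
  refine le_antisymm ((hX.vdist_pow_le_mul hg x k).trans (Nat.mul_le_mul_left k hx)) ?_
  have hgz : ∀ (m : ℕ) u v, X.vdist ((g ^ m) u) ((g ^ m) v) = X.vdist u v := fun m => by
    simpa using vdist_zpow hg (m : ℤ)
  by_contra! hlt
  set D := X.vdist y x
  -- A deficit of one per `g ^ k` accumulates to `m` under `g ^ (k * m)`, whereas the displacements
  -- of `x` and `y` differ by at most `2 * D`.
  set m := 2 * D + 1 with hm
  have h1 := hX.vdist_triangle y x ((g ^ (k * m)) y)
  have h2 := hX.vdist_triangle x ((g ^ (k * m)) x) ((g ^ (k * m)) y)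
  rw [hgz, vdist_comm x y] at h2
  have h3 := hX.vdist_pow_le_mul (hgz k) x m
  rw [← pow_mul] at h3
  have h4 : m * (X.vdist x ((g ^ k) x) + 1) ≤ m * (k * L) := Nat.mul_le_mul_left m hlt
  have h5 : k * m * L = m * (k * L) := by ring
  rw [hy, h5] at h1
  rw [mul_add, mul_one] at h4
  omega

end AbstractSimplicialComplex

theorem corollary3p10 {V : Type*} (X : AbstractSimplicialComplex V)
    (hX : X.IsWeaklySystolic) (hfin : X.IsUniformlyLocallyFinite)
    (h : Equiv.Perm V) (hisom : X.IsSimplicialIsometry h) (hhyp : X.IsHyperbolic h)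
    (n : ℕ) (hn : 1 ≤ n) (hgeo : ∃ γ : ℤ → V, X.IsInvariantGeodesic (h ^ n) γ) :
    ∀ x : V, {x} ∈ X.minDisplacementSet (h ^ n) →
      ∃ γ : ℤ → V, X.IsInvariantGeodesic (h ^ n) γ ∧ x ∈ Set.range γ := by
  intro x hx
  obtain ⟨γ, hγ⟩ := hgeo
  have hg := hisom.vdist_pow n
  have hfix : ∀ v, ((h ^ n) ^ 2) v ≠ v := fun v hv => by
    rw [← pow_mul] at hv
    obtain ⟨s, hs, hmap⟩ := hX.exists_map_eq_of_periodic hfin hisom (by omega) hv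
    exact hhyp s hs hmap
  obtain ⟨t, ht, hshift⟩ := hγ.exists_translation hg hfix
  have hpow : ∀ k : ℕ, ((h ^ n) ^ k) (γ 0) = γ (k * t) := fun k => by
    induction k with
    | zero => simp
    | succ k ih =>
      rw [pow_succ', Equiv.Perm.mul_apply, ih, hshift, Nat.cast_add, Nat.cast_one, add_mul, one_mul]
  have hlin : ∀ k : ℕ, X.vdist (γ 0) (((h ^ n) ^ k) (γ 0)) = k * t.natAbs := fun k => by
    rw [hpow, hγ.1, zero_sub, Int.natAbs_neg, Int.natAbs_mul, Int.natAbs_natCast]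
  have hmin : X.vdist x ((h ^ n) x) ≤ t.natAbs := by
    have h1 : X.displacement (h ^ n) x = X.translationLength (h ^ n) := hx.2 (by simp)
    have h2 : X.translationLength (h ^ n) ≤ X.displacement (h ^ n) (γ 0) := Nat.sInf_le ⟨_, rfl⟩
    have h3 := hlin 1
    rw [pow_one, one_mul, AbstractSimplicialComplex.vdist_comm] at h3
    rw [AbstractSimplicialComplex.vdist_comm, ← h3]
    exact h1.trans_le h2
  exact hX.exists_isInvariantGeodesic hg (Int.natAbs_pos.2 ht) (hX.vdist_pow_eq_mul hg hlin hmin)
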